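/- Let $\triangle=\{(x,y)\in\mathbb R^2: 1>x>y>0\}$ and, for integers $k\ge 0$, let $\triangle_k=\{(x,y)\in\triangle: 1-x-ky\ge 0>1-x-(k+1)y\}$. The triangle map $T$ is defined on $\triangle$ by $$T(x,y)=\left(\frac yx,\frac{1-x-ky}{x}\right)\qquad\text{for }(x,y)\in\triangle_k$$ (points with $1-x-ky=0$ are sent to the boundary of $\triangle$). Its transfer operator with respect to Lebesgue measure is $$(\mathcal L f)(p)=\sum_{q\in\triangle,\;T(q)=p}\frac{f(q)}{|\det DT(q)|},\qquad p\in\triangle,$$ that is, $$(\mathcal L f)(x,y)=\sum_{k=0}^\infty\frac1{(1+kx+y)^3}\,f\!\left(\frac1{1+kx+y},\frac x{1+kx+y}\right).$$ Let $V$ be the real Banach space of all continuous functions $f:\triangle\to\mathbb R$ with $\|f\|=\sup_{(x,y)\in\triangle}|x f(x,y)|<\infty$; $\mathcal L$ is a continuous linear map from $V$ to itself. **Theorem.** The largest eigenvalue of $\mathcal L:V\to V$ is $1$, and its eigenspace is one-dimensional. More precisely: every (real) eigenvalue $\lambda$ of $\mathcal L:V\to V$ satisfies $|\lambda|\le 1$;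 the number $1$ is an eigenvalue of $\mathcal L$; and its eigenspace $\{f\in V:\mathcal L f=f\}$ is one-dimensional, spanned by the function $\dfrac1{x(1+y)}$. -/

import Mathlib

noncomputable section

namespace TriangleMap

open Filter Topology
open scoped BoundedContinuousFunction

/-- The open triangle `{(x, y) : 1 > x > y > 0}`. -/
def triangle : Set (ℝ × ℝ) := {p | p.1 < 1 ∧ p.2 < p.1 ∧ 0 < p.2}

/-- The subtriangle of all `(x, y)` in the triangle with `1 - x - k y ≥ 0 > 1 - x - (k + 1) y`. -/
def subtriangle (k : ℕ) : Set (ℝ × ℝ) :=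
  {p | p ∈ triangle ∧ 0 ≤ 1 - p.1 - k * p.2 ∧ 1 - p.1 - (k + 1) * p.2 < 0}

/-- The `k`-th branch `(x, y) ↦ (y / x, (1 - x - k y) / x)`. -/
def branch (k : ℕ) (p : ℝ × ℝ) : ℝ × ℝ := (p.2 / p.1, (1 - p.1 - k * p.2) / p.1)

/-- The index of the subtriangle that contains a point of the triangle. -/
def index (p : ℝ × ℝ) : ℕ := ⌊(1 - p.1) / p.2⌋₊

/-- The triangle map: it is the `k`-th branch on the `k`-th subtriangle.
(Points with `1 - x - k y = 0` are sent to the boundary of the triangle.) -/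
def triangleMap (p : ℝ × ℝ) : ℝ × ℝ := branch (index p) p

theorem mem_subtriangle_iff {p : ℝ × ℝ} (hp : p ∈ triangle) (k : ℕ) :
    p ∈ subtriangle k ↔ index p = k := by
  obtain ⟨h1, h2, h3⟩ := hp
  have h0 : 0 ≤ (1 - p.1) / p.2 := div_nonneg (by linarith) h3.le
  unfold index
  rw [Nat.floor_eq_iff h0, le_div_iff₀ h3, div_lt_iff₀ h3]
  constructor
  · rintro ⟨-, h4, h5⟩
    exact ⟨by linarith, by linarith⟩
  · rintro ⟨h4, h5⟩
    exact ⟨⟨h1, h2, h3⟩, by linarith, by linarith⟩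

theorem triangleMap_of_mem {p : ℝ × ℝ} {k : ℕ} (hp : p ∈ subtriangle k) :
    triangleMap p = branch k p := by
  rw [triangleMap, (mem_subtriangle_iff hp.1 k).1 hp]

/-- The transfer operator of the triangle map with respect to Lebesgue measure, on functions on
the triangle: the value at `p` is the sum, over the preimages `q` of `p`, of `f q` divided by the
absolute value of the Jacobian determinant of the triangle map at `q`. -/
def transfer (f : triangle → ℝ) (p : triangle) : ℝ :=
  ∑' q : {q : triangle // triangleMap q = p},
    f q / |(fderiv ℝ triangleMap ((q : triangle) : ℝ × ℝ)).det|

/-- The inverse branch `(x, y) ↦ (1 / (1 + k x + y), x / (1 + k x + y))`. -/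
def invBranch (k : ℕ) (p : triangle) : ℝ × ℝ :=
  (1 / (1 + k * p.1.1 + p.1.2), p.1.1 / (1 + k * p.1.1 + p.1.2))

theorem fst_pos (p : triangle) : 0 < p.1.1 := p.2.2.2.trans p.2.2.1

theorem denom_pos (k : ℕ) (p : triangle) : 1 < 1 + k * p.1.1 + p.1.2 := by
  have h1 := fst_pos p
  have h2 := p.2.2.2
  have h3 : 0 ≤ (k : ℝ) * p.1.1 := by positivity
  linarith

theorem invBranch_mem (k : ℕ) (p : triangle) : invBranch k p ∈ triangle := by
  have h1 := fst_pos p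
  have hd := denom_pos k p
  have hd0 : 0 < 1 + k * p.1.1 + p.1.2 := by linarith
  have h4 := p.2.1
  refine ⟨?_, ?_, ?_⟩
  · simp only [invBranch]; rw [div_lt_one hd0]; exact hd
  · simp only [invBranch]; gcongr
  · simp only [invBranch]; positivity

theorem invBranch_ineq (k : ℕ) (p : triangle) :
    0 < 1 - (invBranch k p).1 - k * (invBranch k p).2 ∧
      1 - (invBranch k p).1 - (k + 1) * (invBranch k p).2 < 0 := by
  have hd := denom_pos k p
  have hd0 : 0 < 1 + k * p.1.1 + p.1.2 := by linarith
  have e1 : 1 - (invBranch k p).1 - k * (invBranch k p).2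
      = p.1.2 / (1 + k * p.1.1 + p.1.2) := by
    simp only [invBranch]; field_simp; ring
  have e2 : 1 - (invBranch k p).1 - (k + 1) * (invBranch k p).2
      = (p.1.2 - p.1.1) / (1 + k * p.1.1 + p.1.2) := by
    simp only [invBranch]; field_simp; ring
  rw [e1, e2]
  exact ⟨div_pos p.2.2.2 hd0, div_neg_of_neg_of_pos (by linarith [p.2.2.1]) hd0⟩

theorem invBranch_mem_subtriangle (k : ℕ) (p : triangle) : invBranch k p ∈ subtriangle k :=
  ⟨invBranch_mem k p, (invBranch_ineq k p).1.le, (invBranch_ineq k p).2⟩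

theorem triangleMap_invBranch (k : ℕ) (p : triangle) : triangleMap (invBranch k p) = p := by
  rw [triangleMap_of_mem (invBranch_mem_subtriangle k p)]
  have hd := denom_pos k p
  have hd0 : 1 + k * p.1.1 + p.1.2 ≠ 0 := by linarith
  ext
  · simp only [branch, invBranch]
    rw [div_div_div_cancel_right₀ hd0, div_one]
  · simp only [branch, invBranch]; field_simp; ring

theorem eq_invBranch (q p : triangle) (h : triangleMap q = p) :
    invBranch (index q) p = q := by
  have hq := fst_pos q
  have h1 : p.1.1 = q.1.2 / q.1.1 := by rw [← h]; rfl
  have h2 : p.1.2 = (1 - q.1.1 - index q * q.1.2) / q.1.1 := by rw [← h]; rfl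
  have e : 1 + (index q : ℝ) * p.1.1 + p.1.2 = 1 / q.1.1 := by
    rw [h1, h2]; field_simp; ring
  ext
  · simp only [invBranch, e]; field_simp
  · simp only [invBranch, e]; rw [h1]; field_simp

/-- The preimages of a point of the triangle are its images under the inverse branches. -/
def fibreEquiv (p : triangle) : ℕ ≃ {q : triangle // triangleMap q = p} where
  toFun k := ⟨⟨invBranch k p, invBranch_mem k p⟩, triangleMap_invBranch k p⟩
  invFun q := index q.1
  left_inv k := (mem_subtriangle_iff (invBranch_mem k p) k).1 (invBranch_mem_subtriangle k p)
  right_inv q := Subtype.ext (Subtype.ext (eq_invBranch q.1 p q.2))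

theorem det_fderiv_branch (k : ℕ) (q : ℝ × ℝ) (hq : q.1 ≠ 0) :
    (fderiv ℝ (branch k) q).det = 1 / q.1 ^ 3 := by
  have hf : HasFDerivAt (fun p : ℝ × ℝ => p.1) (ContinuousLinearMap.fst ℝ ℝ ℝ) q := hasFDerivAt_fst
  have hs : HasFDerivAt (fun p : ℝ × ℝ => p.2) (ContinuousLinearMap.snd ℝ ℝ ℝ) q := hasFDerivAt_snd
  have hi := (hasDerivAt_inv hq).comp_hasFDerivAt q hf
  have h1 := hs.mul hi
  have h2 := ((hf.const_sub 1).sub (hs.const_mul (k : ℝ))).mul hi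
  have h3 := h1.prodMk h2
  have h4 : HasFDerivAt (branch k) _ q := h3
  rw [h4.fderiv, ContinuousLinearMap.det, ← LinearMap.det_toMatrix (Module.Basis.finTwoProd ℝ),
    Matrix.det_fin_two]
  simp [LinearMap.toMatrix_apply]
  field_simp
  ring

theorem det_fderiv_invBranch (k : ℕ) (p : triangle) :
    (fderiv ℝ triangleMap (invBranch k p)).det = (1 + k * p.1.1 + p.1.2) ^ 3 := by
  have hq := invBranch_mem k p
  have hq0 : (invBranch k p).1 ≠ 0 := (hq.2.2.trans hq.2.1).ne'
  have key : triangleMap =ᶠ[𝓝 (invBranch k p)] branch k := by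
    have c1 : Continuous fun q : ℝ × ℝ => 1 - q.1 - k * q.2 := by fun_prop
    have c2 : Continuous fun q : ℝ × ℝ => 1 - q.1 - (k + 1) * q.2 := by fun_prop
    filter_upwards [(isOpen_lt continuous_fst continuous_const).mem_nhds hq.1,
      (isOpen_lt continuous_snd continuous_fst).mem_nhds hq.2.1,
      (isOpen_lt continuous_const continuous_snd).mem_nhds hq.2.2,
      (isOpen_lt continuous_const c1).mem_nhds (invBranch_ineq k p).1,
      (isOpen_lt c2 continuous_const).mem_nhds (invBranch_ineq k p).2] with q a b c d e
    exact triangleMap_of_mem ⟨⟨a, b, c⟩, le_of_lt d, e⟩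
  rw [key.fderiv_eq, det_fderiv_branch k _ hq0]
  simp [invBranch]

/-- The transfer operator as a series over the inverse branches. -/
theorem transfer_eq (f : triangle → ℝ) (p : triangle) :
    transfer f p = ∑' k : ℕ, 1 / (1 + k * p.1.1 + p.1.2) ^ 3 *
      f ⟨invBranch k p, invBranch_mem k p⟩ := by
  rw [transfer, ← (fibreEquiv p).tsum_eq]
  refine tsum_congr fun k => ?_
  have hd := denom_pos k p
  have : (0 : ℝ) < (1 + k * p.1.1 + p.1.2) ^ 3 := by positivity
  simp only [fibreEquiv, Equiv.coe_fn_mk]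
  rw [det_fderiv_invBranch, abs_of_pos this]
  ring

/-- The space of continuous real functions `f` on the triangle for which `x f(x, y)` is bounded,
as a subspace of all continuous functions. -/
def weightedSubmodule : Submodule ℝ C(triangle, ℝ) where
  carrier := {f | ∃ C : ℝ, ∀ p : triangle, |p.1.1 * f p| < C}
  zero_mem' := ⟨1, fun p => by simp⟩
  add_mem' := by
    rintro f g ⟨C, hC⟩ ⟨D, hD⟩
    refine ⟨C + D, fun p => ?_⟩
    rw [ContinuousMap.add_apply, mul_add]
    exact (abs_add_le _ _).trans_lt (add_lt_add (hC p) (hD p))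
  smul_mem' := by
    rintro c f ⟨C, hC⟩
    refine ⟨|c| * C + 1, fun p => ?_⟩
    have h : p.1.1 * (c • f) p = c * (p.1.1 * f p) := by
      rw [ContinuousMap.smul_apply, smul_eq_mul]; ring
    rw [h, abs_mul]
    nlinarith [hC p, abs_nonneg c]

/-- The space `V`, a type of its own so that it carries the topology of its norm and not the
topology of `C(triangle, ℝ)`. -/
def V : Type := weightedSubmodule

instance : AddCommGroup V := inferInstanceAs (AddCommGroup weightedSubmodule)

instance : Module ℝ V := inferInstanceAs (Module ℝ weightedSubmodule)

/-- An element of `V` as a function on the triangle. -/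
instance : CoeFun V fun _ => triangle → ℝ := ⟨fun f => f.1⟩

/-- The bounded continuous function `x f(x, y)` attached to `f` in `V`. -/
def weight : V →ₗ[ℝ] (triangle →ᵇ ℝ) where
  toFun f := BoundedContinuousFunction.ofNormedAddCommGroup (fun p : triangle => p.1.1 * f p)
    ((continuous_fst.comp continuous_subtype_val).mul f.1.continuous)
    f.2.choose (fun p => (f.2.choose_spec p).le)
  map_add' f g := by
    ext p
    exact mul_add _ _ _
  map_smul' c f := by
    ext p
    exact mul_left_comm _ _ _

theorem weight_apply (f : V) (p : triangle) : weight f p = p.1.1 * f p := rfl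

theorem weight_injective : Function.Injective weight := by
  intro f g h
  refine Subtype.ext (ContinuousMap.ext fun p => ?_)
  have h1 : weight f p = weight g p := by rw [h]
  rw [weight_apply, weight_apply] at h1
  exact mul_left_cancel₀ (fst_pos p).ne' h1

/-- The norm of `V` is the supremum of `|x f(x, y)|` over the triangle. -/
instance : NormedAddCommGroup V :=
  NormedAddCommGroup.induced V (triangle →ᵇ ℝ) weight weight_injective

instance : NormedSpace ℝ V := NormedSpace.induced ℝ V (triangle →ᵇ ℝ) weight

theorem norm_def (f : V) : ‖f‖ = ⨆ p : triangle, |p.1.1 * f p| :=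
  BoundedContinuousFunction.norm_eq_iSup_norm (weight f)

theorem abs_le_norm (f : V) (p : triangle) : |p.1.1 * f p| ≤ ‖f‖ :=
  BoundedContinuousFunction.norm_coe_le_norm (weight f) p

theorem norm_le (f : V) {C : ℝ} (hC : 0 ≤ C) (h : ∀ p : triangle, |p.1.1 * f p| ≤ C) : ‖f‖ ≤ C :=
  (BoundedContinuousFunction.norm_le hC).2 h

theorem weight_surjective : Function.Surjective weight := by
  intro g
  have hc : Continuous fun p : triangle => g p / p.1.1 :=
    g.continuous.div (continuous_fst.comp continuous_subtype_val) fun p => (fst_pos p).ne'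
  refine ⟨⟨⟨_, hc⟩, ‖g‖ + 1, fun p => ?_⟩, ?_⟩
  · have h : p.1.1 * (g p / p.1.1) = g p := mul_div_cancel₀ _ (fst_pos p).ne'
    change |p.1.1 * (g p / p.1.1)| < _
    rw [h]
    exact (g.norm_coe_le_norm p).trans_lt (lt_add_one _)
  · ext p
    exact mul_div_cancel₀ _ (fst_pos p).ne'

/-- `V` is a Banach space. -/
instance : CompleteSpace V := by
  have hi : Isometry weight := AddMonoidHomClass.isometry_of_norm weight fun _ => rfl
  exact (IsometryEquiv.mk' weight (Function.surjInv weight_surjective)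
    (Function.surjInv_eq weight_surjective) hi).completeSpace

theorem summable_aux {x y : ℝ} (hx : 0 < x) (hx1 : x < 1) (hy : 0 ≤ y) :
    Summable (fun n : ℕ => 1 / (1 + n * x + y) ^ 2) ∧
      x * ∑' n : ℕ, 1 / (1 + n * x + y) ^ 2 ≤ 2 := by
  have hA : ∀ n : ℕ, 1 ≤ 1 + n * x + y := fun n => by
    have : 0 ≤ (n : ℝ) * x := by positivity
    linarith
  have hb : ∀ N : ℕ, ∑ n ∈ Finset.range N, x * (1 / (1 + n * x + y) ^ 2) ≤
      2 - 2 * (1 / (1 + N * x + y)) := by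
    intro N
    induction N with
    | zero =>
      have : 1 / (1 + ((0 : ℕ) : ℝ) * x + y) ≤ 1 := by
        rw [div_le_one (by linarith [hA 0])]; exact hA 0
      simp only [Finset.range_zero, Finset.sum_empty]
      linarith
    | succ N ih =>
      rw [Finset.sum_range_succ]
      have h1 := hA N
      set A := 1 + (N : ℝ) * x + y with hAdef
      have e : 1 + ((N + 1 : ℕ) : ℝ) * x + y = A + x := by push_cast; rw [hAdef]; ring
      rw [e]
      have hA0 : 0 < A := by linarith
      have h2 : x * (1 / A ^ 2) ≤ 2 * (1 / A) - 2 * (1 / (A + x)) := by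
        have e2 : 2 * (1 / A) - 2 * (1 / (A + x)) = x * (2 / (A * (A + x))) := by
          field_simp; ring
        rw [e2]
        refine mul_le_mul_of_nonneg_left ?_ hx.le
        rw [div_le_div_iff₀ (by positivity) (by positivity)]
        nlinarith
      linarith
  have hb2 : ∀ N : ℕ, ∑ n ∈ Finset.range N, x * (1 / (1 + n * x + y) ^ 2) ≤ 2 := fun N => by
    have : 0 ≤ 1 / (1 + N * x + y) := by
      have := hA N
      positivity
    linarith [hb N]
  have hs : Summable fun n : ℕ => x * (1 / (1 + n * x + y) ^ 2) :=
    summable_of_sum_range_le (fun n => by positivity) hb2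
  refine ⟨(summable_mul_left_iff hx.ne').1 hs, ?_⟩
  rw [← tsum_mul_left]
  exact hs.tsum_le_of_sum_range_le hb2

theorem term_bound (f : V) (n : ℕ) (p : triangle) :
    ‖1 / (1 + n * p.1.1 + p.1.2) ^ 3 * f ⟨invBranch n p, invBranch_mem n p⟩‖ ≤
      ‖f‖ * (1 / (1 + n * p.1.1 + p.1.2) ^ 2) := by
  have hd := denom_pos n p
  have h := abs_le_norm f ⟨invBranch n p, invBranch_mem n p⟩
  set v := f ⟨invBranch n p, invBranch_mem n p⟩
  set A := 1 + n * p.1.1 + p.1.2 with hA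
  have hA0 : 0 < A := by linarith
  change |1 / A * v| ≤ ‖f‖ at h
  have e : 1 / A ^ 3 * v = (1 / A * v) * (1 / A ^ 2) := by field_simp
  rw [e, norm_mul, Real.norm_eq_abs, Real.norm_eq_abs, abs_of_pos (a := 1 / A ^ 2) (by positivity)]
  exact mul_le_mul_of_nonneg_right h (by positivity)

theorem summable_term (f : V) (p : triangle) :
    Summable fun n : ℕ => 1 / (1 + n * p.1.1 + p.1.2) ^ 3 *
      f ⟨invBranch n p, invBranch_mem n p⟩ :=
  Summable.of_norm_bounded ((summable_aux (fst_pos p) p.2.1 p.2.2.2.le).1.mul_left ‖f‖)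
    fun n => term_bound f n p

theorem continuous_transfer (f : V) : Continuous (transfer f) := by
  have e : transfer f = fun p : triangle => ∑' n : ℕ, 1 / (1 + n * p.1.1 + p.1.2) ^ 3 *
      f ⟨invBranch n p, invBranch_mem n p⟩ := funext fun p => transfer_eq f p
  rw [e, continuous_iff_continuousAt]
  intro p₀
  have h0 := fst_pos p₀
  have hopen : IsOpen {p : triangle | p₀.1.1 / 2 < p.1.1} :=
    isOpen_lt continuous_const (continuous_fst.comp continuous_subtype_val)
  refine ContinuousOn.continuousAt ?_ (hopen.mem_nhds (half_lt_self h0))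
  refine continuousOn_tsum (u := fun n : ℕ => ‖f‖ * (1 / (1 + n * (p₀.1.1 / 2) + 0) ^ 2)) ?_
    ((summable_aux (half_pos h0) (by linarith [p₀.2.1]) le_rfl).1.mul_left _) ?_
  · intro n
    refine Continuous.continuousOn ?_
    have hd : Continuous fun p : triangle => 1 + n * p.1.1 + p.1.2 := by fun_prop
    have hd0 : ∀ p : triangle, 1 + n * p.1.1 + p.1.2 ≠ 0 := fun p => by
      linarith [denom_pos n p]
    refine (continuous_const.div (hd.pow 3) fun p => pow_ne_zero 3 (hd0 p)).mul ?_
    refine f.1.continuous.comp (Continuous.subtype_mk ?_ _)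
    exact (continuous_const.div hd hd0).prodMk
      ((continuous_fst.comp continuous_subtype_val).div hd hd0)
  · intro n p hp
    refine (term_bound f n p).trans (mul_le_mul_of_nonneg_left ?_ (norm_nonneg f))
    have h1 : (n : ℝ) * (p₀.1.1 / 2) ≤ n * p.1.1 :=
      mul_le_mul_of_nonneg_left (le_of_lt hp) (Nat.cast_nonneg n)
    have h2 := p.2.2.2
    exact one_div_le_one_div_of_le (by positivity)
      (pow_le_pow_left₀ (by positivity) (by linarith) 2)

theorem transfer_bound (f : V) (p : triangle) : |p.1.1 * transfer f p| ≤ 2 * ‖f‖ := by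
  obtain ⟨hs, hb⟩ := summable_aux (fst_pos p) p.2.1 p.2.2.2.le
  have h : ‖transfer f p‖ ≤ ‖f‖ * ∑' n : ℕ, 1 / (1 + n * p.1.1 + p.1.2) ^ 2 := by
    rw [transfer_eq, ← tsum_mul_left]
    exact tsum_of_norm_bounded (hs.mul_left _).hasSum fun n => term_bound f n p
  rw [abs_mul, abs_of_pos (fst_pos p)]
  calc p.1.1 * |transfer f p|
      ≤ p.1.1 * (‖f‖ * ∑' n : ℕ, 1 / (1 + n * p.1.1 + p.1.2) ^ 2) :=
        mul_le_mul_of_nonneg_left h (fst_pos p).le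
    _ = (p.1.1 * ∑' n : ℕ, 1 / (1 + n * p.1.1 + p.1.2) ^ 2) * ‖f‖ := by ring
    _ ≤ 2 * ‖f‖ := mul_le_mul_of_nonneg_right hb (norm_nonneg f)

/-- The transfer operator of the triangle map as a continuous linear map from `V` to itself. -/
def L : V →L[ℝ] V :=
  LinearMap.mkContinuous
    { toFun := fun f => ⟨⟨transfer f, continuous_transfer f⟩, 2 * ‖f‖ + 1, fun p =>
        (transfer_bound f p).trans_lt (lt_add_one _)⟩
      map_add' := fun f g => by
        refine Subtype.ext (ContinuousMap.ext fun p => ?_)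
        change transfer (fun q => f q + g q) p = transfer f p + transfer g p
        rw [transfer_eq, transfer_eq, transfer_eq,
          ← (summable_term f p).tsum_add (summable_term g p)]
        exact tsum_congr fun n => mul_add _ _ _
      map_smul' := fun c f => by
        refine Subtype.ext (ContinuousMap.ext fun p => ?_)
        change transfer (fun q => c * f q) p = c * transfer f p
        rw [transfer_eq, transfer_eq, ← tsum_mul_left]
        exact tsum_congr fun n => mul_left_comm _ _ _ }
    2 fun f => norm_le _ (by positivity) (transfer_bound f)

theorem L_apply (f : V) (p : triangle) : L f p = transfer f p := rfl

/-- The function `1 / (x (1 + y))` as an element of `V`. -/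
def leadingFunction : V :=
  ⟨⟨fun p => 1 / (p.1.1 * (1 + p.1.2)), by
      refine continuous_const.div (by fun_prop) fun p => ?_
      have h1 := fst_pos p
      have h2 := p.2.2.2
      positivity⟩, 2, fun p => by
    have h1 := fst_pos p
    have h2 := p.2.2.2
    have e : p.1.1 * (1 / (p.1.1 * (1 + p.1.2))) = 1 / (1 + p.1.2) := by field_simp
    change |p.1.1 * (1 / (p.1.1 * (1 + p.1.2)))| < 2
    rw [e, abs_of_pos (by positivity), div_lt_iff₀ (by positivity)]
    linarith⟩

theorem leadingFunction_apply (p : triangle) :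
    leadingFunction p = 1 / (p.1.1 * (1 + p.1.2)) := rfl

end TriangleMap

end

noncomputable section

namespace TriangleMap

open Filter Topology

/-! Write h = 1/(x(1+y)) for the leading function. Everything rests on L being a positive operator
that fixes h, together with the boundedness of f/h for every f in V. The identity L h = h is a
telescoping series (`leadingFunction_term`).

Eigenvalue bound: if C is the supremum of |f|/h, then C h ± f ≥ 0. Positivity gives |L f| ≤ C h, so
L f = l f forces |l| C ≤ C, with C > 0 when f ≠ 0.

Simplicity is a maximum principle. Let f be fixed, C = sup f/h and F = C h - f; then F is fixed, F ≥
0 and inf F/h = 0. The triangle is not compact, so this infimum need not be attained a priori.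
However, a bound F ≥ d h on a compact core spreads through the fixed-point equation to F ≥ (d/1200)
h everywhere (`le_of_le_on_core_everywhere`), hence F must vanish somewhere
(`exists_zero_of_fixed`).

A zero of F is carried to zeros by all inverse branches. Iterates of the zeroth branch converge to a
point c that does not depend on the start (`exists_attractor`), so F(c) = 0, that is, f/h attains
its maximum at c. The same holds for -f, so f/h is constant. -/

/-! ### Positivity of the operator and the invariant function -/

/-- The inverse branch as a map of the triangle to itself. -/
def inv (k : ℕ) (p : triangle) : triangle := ⟨invBranch k p, invBranch_mem k p⟩

theorem hasSum_L (f : V) (p : triangle) :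
    HasSum (fun k : ℕ => 1 / (1 + k * p.1.1 + p.1.2) ^ 3 * f (inv k p)) (L f p) := by
  rw [L_apply, transfer_eq]
  exact (summable_term f p).hasSum

theorem V_ext {f g : V} (h : ∀ p : triangle, f p = g p) : f = g :=
  Subtype.ext (ContinuousMap.ext h)

theorem add_apply (f g : V) (p : triangle) : (f + g) p = f p + g p := rfl

theorem sub_apply (f g : V) (p : triangle) : (f - g) p = f p - g p := rfl

theorem smul_apply (c : ℝ) (f : V) (p : triangle) : (c • f) p = c * f p := rfl

theorem L_nonneg {f : V} (hf : ∀ p, 0 ≤ f p) (p : triangle) : 0 ≤ L f p :=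
  (hasSum_L f p).nonneg fun k => by
    have := denom_pos k p
    exact mul_nonneg (by positivity) (hf _)

theorem leadingFunction_pos (p : triangle) : 0 < leadingFunction p := by
  have h1 := fst_pos p
  have h2 := p.2.2.2
  rw [leadingFunction_apply]
  positivity

/-- With A = 1 + kx + y, the inverse branch takes h to A²/(A + x). The weighted term is therefore
1/(A(A + x)), which splits into partial fractions; since A + x is the next denominator, sums over k
telescope. -/
theorem leadingFunction_term (k : ℕ) (p : triangle) :
    1 / (1 + k * p.1.1 + p.1.2) ^ 3 * leadingFunction (inv k p) =
      1 / p.1.1 * (1 / (1 + k * p.1.1 + p.1.2) - 1 / (1 + (k + 1 : ℕ) * p.1.1 + p.1.2)) := by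
  have h1 := fst_pos p
  have hd := denom_pos k p
  rw [leadingFunction_apply]
  change 1 / (1 + k * p.1.1 + p.1.2) ^ 3 * (1 / (1 / (1 + k * p.1.1 + p.1.2) *
    (1 + p.1.1 / (1 + k * p.1.1 + p.1.2)))) = _
  have e : 1 + ((k + 1 : ℕ) : ℝ) * p.1.1 + p.1.2 = (1 + k * p.1.1 + p.1.2) + p.1.1 := by
    push_cast; ring
  rw [e]
  set A := 1 + k * p.1.1 + p.1.2
  have hA : 0 < A := by linarith
  field_simp
  ring

theorem L_leadingFunction : L leadingFunction = leadingFunction := by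
  refine V_ext fun p => ?_
  have h1 := fst_pos p
  have h2 := p.2.2.2
  have h := (hasSum_L leadingFunction p).tendsto_sum_nat
  refine tendsto_nhds_unique h ?_
  simp only [leadingFunction_term, ← Finset.mul_sum]
  have e : ∀ n : ℕ, ∑ k ∈ Finset.range n, (1 / (1 + (k : ℝ) * p.1.1 + p.1.2) -
      1 / (1 + (k + 1 : ℕ) * p.1.1 + p.1.2)) =
      1 / (1 + p.1.2) - 1 / (1 + (n : ℝ) * p.1.1 + p.1.2) := fun n => by
    rw [Finset.sum_range_sub' (fun k : ℕ => 1 / (1 + (k : ℝ) * p.1.1 + p.1.2))]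
    simp
  simp only [e]
  have hA : Tendsto (fun n : ℕ => 1 + (n : ℝ) * p.1.1 + p.1.2) atTop atTop :=
    tendsto_atTop_add_const_right _ _ (tendsto_atTop_add_const_left _ _
      (tendsto_natCast_atTop_atTop.atTop_mul_const h1))
  have ht := (((tendsto_const_nhds (x := (1 : ℝ))).div_atTop hA).const_sub
    (1 / (1 + p.1.2))).const_mul (1 / p.1.1)
  convert ht using 2
  rw [leadingFunction_apply]
  field_simp
  ring

/-! ### The bound on eigenvalues -/

/-- The ratio of an element of `V` to the leading function is bounded. -/
theorem exists_le_leadingFunction (f : V) :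
    ∃ C : ℝ, ∀ p : triangle, |p.1.1 * (1 + p.1.2) * f p| ≤ C := by
  -- The factor 2 bounds 1 + y on the triangle.
  refine ⟨2 * ‖f‖, fun p => ?_⟩
  have h := abs_le_norm f p
  have h2 := p.2.2.2
  have h3 : p.1.2 ≤ 1 := by linarith [p.2.1, p.2.2.1]
  rw [mul_right_comm, abs_mul, abs_of_pos (a := 1 + p.1.2) (by linarith), mul_comm]
  exact mul_le_mul (by linarith) h (abs_nonneg _) (by norm_num)

theorem ratio_le_iff (f : V) (p : triangle) (C : ℝ) :
    p.1.1 * (1 + p.1.2) * f p ≤ C ↔ f p ≤ C * leadingFunction p := by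
  have h1 := fst_pos p
  have h2 := p.2.2.2
  rw [leadingFunction_apply, mul_one_div, le_div_iff₀ (by positivity), mul_comm (f p)]

instance : Nonempty triangle := ⟨⟨(1 / 2, 1 / 4), by norm_num [triangle]⟩⟩

theorem abs_eigenvalue_le_one {l : ℝ} {f : V} (hf : L f = l • f) (h0 : f ≠ 0) : |l| ≤ 1 := by
  obtain ⟨D, hD⟩ := exists_le_leadingFunction f
  set u : triangle → ℝ := fun p => |p.1.1 * (1 + p.1.2) * f p| with hu
  have hb : BddAbove (Set.range u) := ⟨D, by rintro _ ⟨p, rfl⟩; exact hD p⟩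
  set C := ⨆ p, u p with hC
  have hle : ∀ p, u p ≤ C := le_ciSup hb
  have habs : ∀ p, |f p| ≤ C * leadingFunction p := fun p => by
    have h1 := abs_le.1 (hle p)
    refine abs_le.2 ⟨?_, (ratio_le_iff f p C).1 h1.2⟩
    have h2 := (ratio_le_iff (-f) p C).1 (by
      change _ * -(f p) ≤ _
      linarith [h1.1])
    change -(f p) ≤ _ at h2
    linarith
  have hpos : 0 < C := by
    by_contra hneg
    refine h0 (V_ext fun p => ?_)
    have h3 := leadingFunction_pos p
    have : |f p| ≤ 0 := (habs p).trans (mul_nonpos_of_nonpos_of_nonneg (not_lt.1 hneg) h3.le)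
    exact abs_nonpos_iff.1 this
  -- Positivity of L applied to C h - f and C h + f, both nonnegative.
  have hL : ∀ p, |l * f p| ≤ C * leadingFunction p := fun p => by
    have h1 := L_nonneg (f := C • leadingFunction - f) (fun q => by
      rw [sub_apply, smul_apply]; linarith [(abs_le.1 (habs q)).2]) p
    have h2 := L_nonneg (f := C • leadingFunction + f) (fun q => by
      rw [add_apply, smul_apply]; linarith [(abs_le.1 (habs q)).1]) p
    rw [map_sub, map_smul, L_leadingFunction, hf, sub_apply, smul_apply, smul_apply] at h1
    rw [map_add, map_smul, L_leadingFunction, hf, add_apply, smul_apply, smul_apply] at h2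
    exact abs_le.2 ⟨by linarith, by linarith⟩
  have hmul : |l| * C ≤ C := by
    rw [hC, Real.mul_iSup_of_nonneg (abs_nonneg l)]
    refine ciSup_le fun p => ?_
    change |l| * |p.1.1 * (1 + p.1.2) * f p| ≤ C
    rw [← abs_mul, mul_left_comm, abs_mul, abs_of_pos (by
      have h1 := fst_pos p
      have h2 := p.2.2.2
      positivity)]
    have h1 := fst_pos p
    have h2 := p.2.2.2
    have h3 := mul_le_mul_of_nonneg_left (hL p)
      (show 0 ≤ p.1.1 * (1 + p.1.2) by positivity)
    refine h3.trans (le_of_eq ?_)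
    rw [leadingFunction_apply]
    field_simp
  exact (mul_le_iff_le_one_left hpos).1 hmul

/-! ### Nonnegative fixed functions: Harnack-type bounds and zeros -/

section Fixed

variable {F : V}

theorem sum_le_of_fixed (hF : L F = F) (h0 : ∀ p, 0 ≤ F p) (s : Finset ℕ) (p : triangle) :
    ∑ k ∈ s, 1 / (1 + k * p.1.1 + p.1.2) ^ 3 * F (inv k p) ≤ F p := by
  have h := hasSum_L F p
  rw [hF] at h
  exact sum_le_hasSum s (fun k _ => by
    have := denom_pos k p
    exact mul_nonneg (by positivity) (h0 _)) h

/-- A sum of nonnegative terms with positive weights vanishes only if every term does. -/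
theorem eq_zero_inv_of_fixed (hF : L F = F) (h0 : ∀ p, 0 ≤ F p) {p : triangle} (hp : F p = 0)
    (k : ℕ) : F (inv k p) = 0 := by
  have h := sum_le_of_fixed hF h0 {k} p
  have hd := denom_pos k p
  rw [Finset.sum_singleton, hp] at h
  have h1 : 0 < 1 / (1 + k * p.1.1 + p.1.2) ^ 3 := by positivity
  exact le_antisymm (nonpos_of_mul_nonpos_right h h1) (h0 _)

/-- A compact part of the triangle. -/
def core : Set triangle := {p | p.1.1 ≤ 29 / 30 ∧ p.1.2 + 1 / 30 ≤ p.1.1 ∧ 1 / 30 ≤ p.1.2}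

theorem isCompact_core : IsCompact core := by
  rw [Subtype.isCompact_iff]
  have e : (Subtype.val '' core : Set (ℝ × ℝ)) = {p : ℝ × ℝ | p.1 ≤ 29 / 30} ∩
      ({p : ℝ × ℝ | p.2 + 1 / 30 ≤ p.1} ∩ {p : ℝ × ℝ | 1 / 30 ≤ p.2}) := by
    ext p
    constructor
    · rintro ⟨q, hq, rfl⟩
      exact hq
    · rintro ⟨h1, h2, h3⟩
      simp only [Set.mem_ofPred_eq] at h1 h2 h3
      exact ⟨⟨p, by linarith, by linarith, by linarith⟩, ⟨h1, h2, h3⟩, rfl⟩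
  rw [e]
  refine IsCompact.of_isClosed_subset (isCompact_Icc (a := ((0 : ℝ), (0 : ℝ)))
    (b := ((1 : ℝ), (1 : ℝ)))) ?_ ?_
  · exact (isClosed_le (by fun_prop) (by fun_prop)).inter
      ((isClosed_le (by fun_prop) (by fun_prop)).inter (isClosed_le (by fun_prop) (by fun_prop)))
  · rintro p ⟨h1, h2, h3⟩
    simp only [Set.mem_ofPred_eq] at h1 h2 h3
    exact ⟨⟨by simp only; linarith, by simp only; linarith⟩,
      ⟨by simp only; linarith, by simp only; linarith⟩⟩

/-- The strip is not compact in the triangle: y may tend to 0 or to x. Branch 1 still pulls it into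
the core, since 1 + x + y stays between 11/10 and 2. Branch 0 would fail, as 1/(1 + y) tends to 1
when y tends to 0. -/
theorem inv_one_mem_core {p : triangle} (h1 : 1 / 10 ≤ p.1.1) (h2 : p.1.1 ≤ 1 / 2) :
    inv 1 p ∈ core := by
  have h3 := p.2.2.1
  have h4 := p.2.2.2
  have hA : 0 < 1 + ((1 : ℕ) : ℝ) * p.1.1 + p.1.2 := by push_cast; linarith
  refine ⟨?_, ?_, ?_⟩
  · change 1 / (1 + ((1 : ℕ) : ℝ) * p.1.1 + p.1.2) ≤ 29 / 30
    rw [div_le_div_iff₀ hA (by norm_num)]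
    push_cast
    linarith
  · change p.1.1 / (1 + ((1 : ℕ) : ℝ) * p.1.1 + p.1.2) + 1 / 30 ≤
      1 / (1 + ((1 : ℕ) : ℝ) * p.1.1 + p.1.2)
    rw [← le_sub_iff_add_le', ← sub_div, div_le_div_iff₀ (by norm_num) hA]
    push_cast
    linarith
  · change 1 / 30 ≤ p.1.1 / (1 + ((1 : ℕ) : ℝ) * p.1.1 + p.1.2)
    rw [div_le_div_iff₀ (by norm_num) hA]
    push_cast
    linarith

/-- A lower bound on the core propagates to a lower bound in a strip. -/
theorem le_of_le_on_core (hF : L F = F) (h0 : ∀ p, 0 ≤ F p) {d : ℝ} (hd : 0 ≤ d)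
    (hcore : ∀ p ∈ core, d * leadingFunction p ≤ F p) {p : triangle}
    (h1 : 1 / 10 ≤ p.1.1) (h2 : p.1.1 ≤ 1 / 2) : d / 60 * leadingFunction p ≤ F p := by
  -- Only the branch k = 1 is kept, since it lands in the core.
  have h := sum_le_of_fixed hF h0 {1} p
  rw [Finset.sum_singleton] at h
  refine le_trans ?_ h
  have h3 := p.2.2.1
  have h4 := p.2.2.2
  have hA := denom_pos 1 p
  have h5 := mul_le_mul_of_nonneg_left (hcore _ (inv_one_mem_core h1 h2))
    (show 0 ≤ 1 / (1 + ((1 : ℕ) : ℝ) * p.1.1 + p.1.2) ^ 3 by positivity)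
  refine le_trans ?_ h5
  rw [mul_left_comm, leadingFunction_term, div_mul_eq_mul_div, mul_div_assoc]
  refine mul_le_mul_of_nonneg_left ?_ hd
  rw [leadingFunction_apply]
  push_cast
  have e : 1 / p.1.1 * (1 / (1 + 1 * p.1.1 + p.1.2) - 1 / (1 + 2 * p.1.1 + p.1.2)) =
      1 / ((1 + 1 * p.1.1 + p.1.2) * (1 + 2 * p.1.1 + p.1.2)) := by
    have : 1 + 1 * p.1.1 + p.1.2 ≠ 0 := by linarith
    have : 1 + 2 * p.1.1 + p.1.2 ≠ 0 := by linarith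
    have : p.1.1 ≠ 0 := by linarith
    field_simp
    ring
  rw [e, div_div]
  -- The constant 60 works because (1 + x + y)(1 + 2x + y) ≤ 5 on the strip, while 60 x(1 + y) ≥ 6.
  refine one_div_le_one_div_of_le (mul_pos (by linarith) (by linarith)) ?_
  nlinarith

/-- A lower bound on the core propagates to a lower bound everywhere. -/
theorem le_of_le_on_core_everywhere (hF : L F = F) (h0 : ∀ p, 0 ≤ F p) {d : ℝ} (hd : 0 ≤ d)
    (hcore : ∀ p ∈ core, d * leadingFunction p ≤ F p) (p : triangle) :
    d / 1200 * leadingFunction p ≤ F p := by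
  have hx := fst_pos p
  have hx1 := p.2.1
  have hy := p.2.2.2
  have hy1 := p.2.2.1
  -- For m ≤ k < 4m the denominator 1 + kx + y lies between 2 and 10, so the k-th preimage falls in
  -- the strip 1/10 ≤ x ≤ 1/2. This block of branches carries a fixed proportion of h, however small
  -- x is.
  obtain ⟨m, hm1, hm2⟩ : ∃ m : ℕ, 1 ≤ m * p.1.1 ∧ m * p.1.1 ≤ 2 := by
    refine ⟨⌈1 / p.1.1⌉₊, ?_, ?_⟩
    · rw [← div_le_iff₀ hx]
      exact Nat.le_ceil _
    · have h := Nat.ceil_lt_add_one (show 0 ≤ 1 / p.1.1 by positivity)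
      have h' := mul_le_mul_of_nonneg_right h.le hx.le
      rw [add_mul, div_mul_cancel₀ _ hx.ne'] at h'
      linarith
  refine le_trans ?_ (sum_le_of_fixed hF h0 (Finset.Ico m (4 * m)) p)
  have hterm : ∀ k ∈ Finset.Ico m (4 * m), d / 60 * (1 / p.1.1 *
      (1 / (1 + k * p.1.1 + p.1.2) - 1 / (1 + (k + 1 : ℕ) * p.1.1 + p.1.2))) ≤
      1 / (1 + k * p.1.1 + p.1.2) ^ 3 * F (inv k p) := by
    intro k hk
    rw [Finset.mem_Ico] at hk
    have hk1 : (m : ℝ) ≤ k := by exact_mod_cast hk.1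
    have hk2 : (k : ℝ) ≤ 4 * m := by exact_mod_cast hk.2.le
    have hA := denom_pos k p
    have hA1 := mul_le_mul_of_nonneg_right hk1 hx.le
    have hA2 := mul_le_mul_of_nonneg_right hk2 hx.le
    rw [← leadingFunction_term, mul_left_comm]
    refine mul_le_mul_of_nonneg_left (le_of_le_on_core hF h0 hd hcore ?_ ?_) (by positivity)
    · change 1 / 10 ≤ 1 / (1 + k * p.1.1 + p.1.2)
      exact one_div_le_one_div_of_le (by linarith) (by linarith)
    · change 1 / (1 + k * p.1.1 + p.1.2) ≤ 1 / 2
      exact one_div_le_one_div_of_le (by norm_num) (by linarith)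
  refine le_trans ?_ (Finset.sum_le_sum hterm)
  rw [← Finset.mul_sum, ← Finset.mul_sum]
  have hsum : ∑ k ∈ Finset.Ico m (4 * m), (1 / (1 + (k : ℝ) * p.1.1 + p.1.2) -
      1 / (1 + (k + 1 : ℕ) * p.1.1 + p.1.2)) =
      1 / (1 + (m : ℝ) * p.1.1 + p.1.2) - 1 / (1 + (4 * m : ℕ) * p.1.1 + p.1.2) := by
    have := Finset.sum_Ico_sub (fun k : ℕ => -(1 / (1 + (k : ℝ) * p.1.1 + p.1.2)))
      (show m ≤ 4 * m by omega)
    simp only [neg_sub_neg] at this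
    exact this
  rw [hsum, leadingFunction_apply]
  -- From 1 ≤ mx ≤ 2, the telescoped difference is at least 1/4 - 1/5 = 1/20, and 60 · 20 = 1200.
  have b1 : 1 / 4 ≤ 1 / (1 + (m : ℝ) * p.1.1 + p.1.2) :=
    one_div_le_one_div_of_le (by linarith) (by linarith)
  have b2 : 1 / (1 + (4 * m : ℕ) * p.1.1 + p.1.2) ≤ 1 / 5 :=
    one_div_le_one_div_of_le (by norm_num) (by push_cast; linarith)
  have b3 : 1 / (p.1.1 * (1 + p.1.2)) ≤ 1 / p.1.1 :=
    one_div_le_one_div_of_le hx (by nlinarith)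
  calc d / 1200 * (1 / (p.1.1 * (1 + p.1.2))) ≤ d / 1200 * (1 / p.1.1) := by gcongr
    _ = d / 60 * (1 / p.1.1 * (1 / 20)) := by ring
    _ ≤ _ := by
      gcongr
      linarith

/-- If F were positive everywhere, F/h would have a positive minimum on the compact core, and
propagating it would bound F/h away from 0 on the whole triangle. -/
theorem exists_zero_of_fixed (hF : L F = F) (h0 : ∀ p, 0 ≤ F p)
    (hinf : ∀ e > 0, ∃ p, F p < e * leadingFunction p) : ∃ p, F p = 0 := by
  by_contra! hne
  have hpos : ∀ p, 0 < F p := fun p => lt_of_le_of_ne (h0 p) (hne p).symm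
  have hcont : Continuous fun p : triangle => F p / leadingFunction p :=
    F.1.continuous.div leadingFunction.1.continuous fun p => (leadingFunction_pos p).ne'
  have hnon : core.Nonempty := ⟨⟨(1 / 2, 1 / 4), by norm_num [triangle]⟩, by norm_num [core]⟩
  obtain ⟨q, -, hq⟩ := isCompact_core.exists_isMinOn hnon hcont.continuousOn
  have hd : 0 < F q / leadingFunction q := div_pos (hpos q) (leadingFunction_pos q)
  obtain ⟨p, hp⟩ := hinf _ (div_pos hd (show (0 : ℝ) < 1200 by norm_num))
  refine absurd (le_of_le_on_core_everywhere hF h0 hd.le (fun r hr => ?_) p) (not_le.2 hp)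
  rw [← le_div_iff₀ (leadingFunction_pos r)]
  exact hq hr

end Fixed

/-! ### The attracting fixed point of the zeroth inverse branch -/

/-- The point (s, s²) is fixed by the zeroth inverse branch exactly when s(1 + s²) = 1. The
numerical bounds on s feed the contraction estimate. -/
theorem exists_root : ∃ s : ℝ, 3 / 5 ≤ s ∧ s ≤ 7 / 10 ∧ s + s ^ 3 = 1 := by
  have h := intermediate_value_Icc (show (3 / 5 : ℝ) ≤ 7 / 10 by norm_num)
    (f := fun s : ℝ => s + s ^ 3) (by fun_prop)
  obtain ⟨s, hs, e⟩ := h (show (1 : ℝ) ∈ _ by constructor <;> norm_num)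
  exact ⟨s, hs.1, hs.2, e⟩

/-- The combination e(n+1) + e(n)/2 shrinks by the factor 9/10 at each step: 2/5 + 1/2 = 9/10 and
9/20 = (9/10)/2. -/
theorem tendsto_zero_of_le {e : ℕ → ℝ} (h0 : ∀ n, 0 ≤ e n)
    (h : ∀ n, e (n + 2) ≤ 2 / 5 * e (n + 1) + 9 / 20 * e n) : Tendsto e atTop (𝓝 0) := by
  have hb : ∀ n, e (n + 1) + 1 / 2 * e n ≤ (9 / 10) ^ n * (e 1 + 1 / 2 * e 0) := by
    intro n
    induction n with
    | zero => simp
    | succ n ih =>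
      rw [pow_succ]
      linarith [h n, h0 n, h0 (n + 1)]
  have ht : Tendsto (fun n : ℕ => (9 / 10 : ℝ) ^ n * (e 1 + 1 / 2 * e 0) * 2) atTop (𝓝 0) := by
    have := ((tendsto_pow_atTop_nhds_zero_of_lt_one (r := (9 / 10 : ℝ)) (by norm_num)
      (by norm_num)).mul_const (e 1 + 1 / 2 * e 0)).mul_const 2
    simpa using this
  exact squeeze_zero h0 (fun n => by linarith [hb n, h0 (n + 1)]) ht

/-- The iterates of the zeroth inverse branch converge to its fixed point. -/
theorem exists_attractor : ∃ c : triangle, ∀ q : triangle,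
    Tendsto (fun n => (inv 0)^[n] q) atTop (𝓝 c) := by
  obtain ⟨s, hs1, hs2, hs⟩ := exists_root
  refine ⟨⟨(s, s ^ 2), by simp only; linarith, by simp only; nlinarith, by simp only; nlinarith⟩,
    fun q => ?_⟩
  set x : ℕ → ℝ := fun n => ((inv 0)^[n] q).1.1 with hx
  set y : ℕ → ℝ := fun n => ((inv 0)^[n] q).1.2 with hy
  have hx0 : ∀ n, 0 < x n := fun n => fst_pos _
  have hx1 : ∀ n, x n < 1 := fun n => ((inv 0)^[n] q).2.1
  have hy0 : ∀ n, 0 < y n := fun n => ((inv 0)^[n] q).2.2.2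
  have hxs : ∀ n, x (n + 1) * (1 + y n) = 1 := fun n => by
    have h1 := hy0 n
    have : x (n + 1) = 1 / (1 + y n) := by
      simp only [hx, hy, Function.iterate_succ_apply']
      simp [inv, invBranch]
    rw [this]
    field_simp
  have hys : ∀ n, y (n + 1) = x n * x (n + 1) := fun n => by
    have h1 := hy0 n
    have : y (n + 1) = x n / (1 + y n) := by
      simp only [hx, hy, Function.iterate_succ_apply']
      simp [inv, invBranch]
    rw [this, div_eq_iff (by linarith), mul_assoc, hxs, mul_one]
  -- Eliminating y leaves a second-order recursion for x alone.
  have hrec : ∀ n, x (n + 2) * (1 + x n * x (n + 1)) = 1 := fun n => by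
    rw [← hys]
    exact hxs (n + 1)
  have hlow : ∀ n, 1 / 2 ≤ x (n + 1) := fun n => by
    have h1 : y n < 1 := ((inv 0)^[n] q).2.2.1.trans (hx1 n)
    nlinarith [hxs n, hx0 (n + 1)]
  -- The bound x ≥ 1/2 holds from index 1 on, so two consecutive factors give x ≤ 1/(1 + 1/4) from
  -- index 3 on; hence the shift by 3 below.
  have hup : ∀ n, x (n + 3) ≤ 4 / 5 := fun n => by
    have h1 : 1 / 4 ≤ x (n + 1) * x (n + 2) := by nlinarith [hlow n, hlow (n + 1)]
    nlinarith [hrec (n + 1), hx0 (n + 3)]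
  have hconv : Tendsto (fun n => |x (n + 3) - s|) atTop (𝓝 0) := by
    refine tendsto_zero_of_le (fun n => abs_nonneg _) fun n => ?_
    -- Difference of the reciprocals of 1 + x(n+3)x(n+4) and 1 + s², with the difference of products
    -- split into two increments.
    have e : x (n + 5) - s = -(s * x (n + 5)) * (x (n + 4) * (x (n + 3) - s) +
        s * (x (n + 4) - s)) := by
      have h1 := hrec (n + 3)
      linear_combination (-x (n + 5)) * hs + s * h1
    have hu3 := hup n
    have hu4 := hup (n + 1)
    have hu5 := hup (n + 2)
    have p4 := hx0 (n + 4)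
    have p5 := hx0 (n + 5)
    change |x (n + 5) - s| ≤ _ * |x (n + 4) - s| + _ * _
    change x (n + 4) ≤ _ at hu4
    change x (n + 5) ≤ _ at hu5
    have hs0 : 0 < s := by linarith
    -- Here 14/25 = (7/10)(4/5). The final coefficients are 56/125 ≤ 9/20 and 49/125 ≤ 2/5, as
    -- `tendsto_zero_of_le` requires.
    have c1 : s * x (n + 5) ≤ 14 / 25 := by nlinarith
    have c0 : 0 < s * x (n + 5) := by positivity
    have a3 := abs_nonneg (x (n + 3) - s)
    have a4 := abs_nonneg (x (n + 4) - s)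
    have tri : |x (n + 4) * (x (n + 3) - s) + s * (x (n + 4) - s)| ≤
        4 / 5 * |x (n + 3) - s| + 7 / 10 * |x (n + 4) - s| := by
      refine (abs_add_le _ _).trans (add_le_add ?_ ?_)
      · rw [abs_mul, abs_of_pos p4]
        gcongr
      · rw [abs_mul, abs_of_pos hs0]
        gcongr
    calc |x (n + 5) - s| = s * x (n + 5) * |x (n + 4) * (x (n + 3) - s) +
          s * (x (n + 4) - s)| := by
          rw [e, abs_mul, abs_neg, abs_of_pos c0]
      _ ≤ 14 / 25 * (4 / 5 * |x (n + 3) - s| + 7 / 10 * |x (n + 4) - s|) := by gcongr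
      _ ≤ _ := by linarith
  have hxlim : Tendsto x atTop (𝓝 s) := by
    rw [← tendsto_add_atTop_iff_nat 3, tendsto_iff_dist_tendsto_zero]
    exact hconv
  have hylim : Tendsto y atTop (𝓝 (s ^ 2)) := by
    rw [← tendsto_add_atTop_iff_nat 1, sq]
    simp only [hys]
    exact hxlim.mul ((tendsto_add_atTop_iff_nat 1).2 hxlim)
  rw [tendsto_subtype_rng]
  exact hxlim.prodMk_nhds hylim

/-! ### Uniqueness of the fixed function -/

/-- A fixed function lies between its values at the attractor, relative to the leading function. -/
theorem le_of_fixed {c : triangle}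
    (hc : ∀ q : triangle, Tendsto (fun n => (inv 0)^[n] q) atTop (𝓝 c)) {f : V}
    (hf : L f = f) (p : triangle) :
    f p ≤ f c / leadingFunction c * leadingFunction p := by
  obtain ⟨D, hD⟩ := exists_le_leadingFunction f
  set u : triangle → ℝ := fun p => p.1.1 * (1 + p.1.2) * f p with hu
  have hb : BddAbove (Set.range u) := ⟨D, by rintro _ ⟨p, rfl⟩; exact (abs_le.1 (hD p)).2⟩
  set C := ⨆ p, u p with hC
  have hle : ∀ p, f p ≤ C * leadingFunction p := fun p =>
    (ratio_le_iff f p C).1 (le_ciSup hb p)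
  set F : V := C • leadingFunction - f with hFdef
  have hval : ∀ p, F p = C * leadingFunction p - f p := fun p => rfl
  have hF : L F = F := by rw [hFdef, map_sub, map_smul, L_leadingFunction, hf]
  have h0 : ∀ p, 0 ≤ F p := fun p => by rw [hval]; linarith [hle p]
  -- As C is the least upper bound of f/h, the ratio F/h takes values below every e > 0.
  obtain ⟨q, hq⟩ := exists_zero_of_fixed hF h0 fun e he => by
    obtain ⟨p, hp⟩ := exists_lt_of_lt_ciSup (show C - e < ⨆ p, u p by linarith)
    refine ⟨p, ?_⟩
    have := mt (ratio_le_iff f p (C - e)).2 (not_le.2 hp)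
    rw [hval]
    linarith
  have hit : ∀ n, F ((inv 0)^[n] q) = 0 := fun n => by
    induction n with
    | zero => exact hq
    | succ n ih =>
      rw [Function.iterate_succ_apply']
      exact eq_zero_inv_of_fixed hF h0 ih 0
  have hlim : Tendsto (fun n => F ((inv 0)^[n] q)) atTop (𝓝 (F c)) :=
    (F.1.continuous.tendsto c).comp (hc q)
  simp only [hit] at hlim
  -- F vanishes along the orbit of q, which converges to c, and F is continuous; hence C is the
  -- value of f/h at c.
  have hFc : F c = 0 := tendsto_nhds_unique hlim tendsto_const_nhds
  rw [hval] at hFc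
  have e : f c / leadingFunction c = C := by
    rw [div_eq_iff (leadingFunction_pos c).ne']
    linarith
  rw [e]
  exact hle p

theorem exists_eq_smul_of_fixed {f : V} (hf : L f = f) : ∃ a : ℝ, a • leadingFunction = f := by
  obtain ⟨c, hc⟩ := exists_attractor
  refine ⟨f c / leadingFunction c, V_ext fun p => ?_⟩
  have h1 := le_of_fixed hc hf p
  -- The point c does not depend on f, so the bound for -f is the reverse inequality with the same
  -- constant.
  have h2 := le_of_fixed hc (f := -f) (by rw [map_neg, hf]) p
  change -(f p) ≤ -(f c) / _ * _ at h2
  rw [neg_div, neg_mul] at h2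
  rw [smul_apply]
  linarith

theorem leadingFunction_ne_zero : leadingFunction ≠ 0 := fun h => by
  obtain ⟨p⟩ : Nonempty triangle := inferInstance
  have h1 := leadingFunction_pos p
  rw [h] at h1
  exact lt_irrefl _ h1

theorem eigenspace_one : Module.End.eigenspace (L : V →ₗ[ℝ] V) 1 =
    Submodule.span ℝ {leadingFunction} := by
  ext f
  rw [Module.End.mem_eigenspace_iff, Submodule.mem_span_singleton, one_smul]
  constructor
  · exact fun h => exists_eq_smul_of_fixed h
  · rintro ⟨a, rfl⟩
    change L (a • leadingFunction) = _
    rw [map_smul, L_leadingFunction]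

end TriangleMap

end

theorem mainTheorem1 :
    (∀ l : ℝ, Module.End.HasEigenvalue (TriangleMap.L : TriangleMap.V →ₗ[ℝ] TriangleMap.V) l →
      |l| ≤ 1) ∧
    Module.End.HasEigenvalue (TriangleMap.L : TriangleMap.V →ₗ[ℝ] TriangleMap.V) 1 ∧
    Module.finrank ℝ
      (Module.End.eigenspace (TriangleMap.L : TriangleMap.V →ₗ[ℝ] TriangleMap.V) 1) = 1 ∧
    Module.End.eigenspace (TriangleMap.L : TriangleMap.V →ₗ[ℝ] TriangleMap.V) 1 =
      Submodule.span ℝ {TriangleMap.leadingFunction} := by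
  refine ⟨fun l hl => ?_, ?_, ?_, TriangleMap.eigenspace_one⟩
  · obtain ⟨f, hf⟩ := hl.exists_hasEigenvector
    exact TriangleMap.abs_eigenvalue_le_one hf.apply_eq_smul hf.2
  · rw [Module.End.hasEigenvalue_iff, TriangleMap.eigenspace_one, Ne,
      Submodule.span_singleton_eq_bot]
    exact TriangleMap.leadingFunction_ne_zero
  · rw [TriangleMap.eigenspace_one]
    exact finrank_span_singleton TriangleMap.leadingFunction_ne_zero
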